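/- Let $R$ be an integral domain with quotient field $L$. Let $F(R)$ be the set of nonzero fractional ideals of $R$. A star operation on $R$ is a map $*\colon F(R)\to F(R)$, $E\mapsto E^*$, such that for all $a\in L\setminus\{0\}$ and $E,F\in F(R)$: $R^*=R$ and $(aE)^*=aE^*$; $E\subseteq E^*$, and $E\subseteq F$ implies $E^*\subseteq F^*$; $(E^*)^*=E^*$. It is of finite type if, for every $E\in F(R)$, $E^*=\bigcup F^*$, the union being over all nonzero finitely generated fractional ideals $F\subseteq E$ of $R$. Let $\mathrm{StarFC}(R)$ be the set of star operations of finite type on $R$. An overring of $R$ is a ring $T$ with $R\subseteq T\subseteq L$. The domain $R$ is called finitely star regular if $|\mathrm{StarFC}(T)|\le|\mathrm{StarFC}(R)|$ for every overring $T$ of $R$, where $|\cdot|$ denotes the number of elements in $\{0,1,2,\dots\}\cup\{\infty\}$ (all infinite sets are given the same size $\infty$). **Proposition.** Every integrally closed domain is finitely star regular. -/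

import Mathlib

open scoped nonZeroDivisors

section StarOperations

variable (A : Type*) [CommRing A] (K : Type*) [Field K] [Algebra A K] [IsFractionRing A K]

/-- `F(A)`: the nonzero fractional ideals of a domain `A` with quotient field `K`. -/
abbrev NonzeroFracIdeal := {E : FractionalIdeal A⁰ K // E ≠ 0}

variable {A K}

/-- The fractional ideal `aE`, for `a` a nonzero element of the quotient field. -/
noncomputable def NonzeroFracIdeal.scale (a : K) (ha : a ≠ 0) (E : NonzeroFracIdeal A K) :
    NonzeroFracIdeal A K :=
  ⟨FractionalIdeal.spanSingleton A⁰ a * E.1, by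
    intro h
    apply E.2
    rw [FractionalIdeal.eq_zero_iff]
    intro x hx
    have hax : a * x ∈ FractionalIdeal.spanSingleton A⁰ a * E.1 :=
      FractionalIdeal.mul_mem_mul (FractionalIdeal.mem_spanSingleton_self A⁰ a) hx
    rw [h, FractionalIdeal.mem_zero_iff] at hax
    exact (mul_eq_zero.mp hax).resolve_left ha⟩

/-- The domain `A` itself as a nonzero fractional ideal. -/
noncomputable def NonzeroFracIdeal.unit : NonzeroFracIdeal A K :=
  ⟨1, one_ne_zero⟩

variable (A K)

/-- Star operations on the domain `A` with quotient field `K`. -/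
@[ext]
structure StarOperation where
  /-- the map `E ↦ E^*` -/
  star : NonzeroFracIdeal A K → NonzeroFracIdeal A K
  /-- `A^* = A` -/
  star_unit : star NonzeroFracIdeal.unit = NonzeroFracIdeal.unit
  /-- `(aE)^* = aE^*` -/
  star_scale : ∀ (a : K) (ha : a ≠ 0) (E : NonzeroFracIdeal A K),
    star (E.scale a ha) = (star E).scale a ha
  /-- `E ⊆ E^*` -/
  le_star : ∀ E : NonzeroFracIdeal A K, E ≤ star E
  /-- `E ⊆ F` implies `E^* ⊆ F^*` -/
  star_mono : ∀ E F : NonzeroFracIdeal A K, E ≤ F → star E ≤ star F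
  /-- `(E^*)^* = E^*` -/
  star_star : ∀ E : NonzeroFracIdeal A K, star (star E) = star E

variable {A K}

/-- A star operation is of finite type if `E^*` is the union of the `F^*`, with `F` ranging over
the nonzero finitely generated fractional ideals contained in `E`. -/
def StarOperation.IsFiniteType (s : StarOperation A K) : Prop :=
  ∀ E : NonzeroFracIdeal A K,
    {x : K | x ∈ (s.star E).1} =
      ⋃ F ∈ {F : NonzeroFracIdeal A K | F ≤ E ∧ (F.1 : Submodule A K).FG},
        {x : K | x ∈ (s.star F).1}

variable (A K)

/-- The set of star operations of finite type on `A`. -/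
def StarFC : Set (StarOperation A K) := {s | s.IsFiniteType}

end StarOperations

/-- `R` is finitely star regular: `|StarFC(T)| ≤ |StarFC(R)|` for every ring `T` between `R` and
its quotient field `K`. Cardinalities take values in `ℕ ∪ {∞}`. -/
def IsFinitelyStarRegular (R : Type*) [CommRing R] [IsDomain R] (K : Type*) [Field K]
    [Algebra R K] [IsFractionRing R K] : Prop :=
  ∀ T : Subalgebra R K, (StarFC T K).encard ≤ (StarFC R K).encard

/-!
For a domain `A` with quotient field `K`, consider the splitting condition: for all `x y : K` there
are `c + d = 1` in `A` with `c x ∈ A y` and `d y ∈ A x`. (It says that `A` is a Prüfer domain.)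
It passes from `A` to every overring, and the number of star operations of finite type depends on
whether it holds.

If it holds, then a finitely generated `F = (x₁, …, xₙ)` admits a partition of unity `∑ eᵢ = 1`
with `eᵢ F ⊆ A xᵢ` (`HasSplitting.exists_partition`). Applying a star operation `*` gives
`eᵢ F^* ⊆ A xᵢ ⊆ F`, so that `F^* = F`. Hence the identity is the only star operation of
finite type (`HasSplitting.subsingleton_starFC`).

If it fails and `A` is integrally closed, there is `u ≠ 0` in `K` such that `1` is not a sum `b + g`
with `b, b u, g, g u⁻¹ ∈ A`. Since `A[v] ∩ A[v⁻¹] = A` for every `v ≠ 0`, each `n ≥ 1` gives the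
star operation of finite type `E ↦ E A[uⁿ] ∩ E A[u⁻ⁿ]`. These are pairwise distinct: `uᵐ` belongs to
the image of the ideal generated by `1` and `u²ᵐ` exactly when `n ∣ m`. Indeed, if `n ∤ m`, such a
membership is a polynomial relation for `u` whose `m`-th coefficient is `1`, whereas every
coefficient of a polynomial over `A` vanishing at `u` is a sum `b + g` as above
(`exists_coeff_eq_add`, a global form of Seidenberg's lemma on `u` and `u⁻¹`). So there are
infinitely many star operations of finite type on `A` (`infinite_starFC`).
-/

open Polynomial

section

variable {A : Type*} [CommRing A] {K : Type*} [Field K] [Algebra A K]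

/-! ### Partitions of unity -/

variable (A K) in
/-- The splitting condition on a domain `A` with quotient field `K`, equivalent to `A` being a
Prüfer domain: `A` is covered by two principal open sets, on one of which `y` divides `x` while on
the other one `x` divides `y`. -/
def HasSplitting : Prop :=
  ∀ x y : K, ∃ c d : A, c + d = 1 ∧ c • x ∈ Submodule.span A {y} ∧ d • y ∈ Submodule.span A {x}

theorem HasSplitting.subalgebra (h : HasSplitting A K) (T : Subalgebra A K) :
    HasSplitting T K := by
  intro x y
  obtain ⟨c, d, hcd, hc, hd⟩ := h x y
  obtain ⟨r, hr⟩ := Submodule.mem_span_singleton.mp hc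
  obtain ⟨s, hs⟩ := Submodule.mem_span_singleton.mp hd
  refine ⟨algebraMap A T c, algebraMap A T d, by rw [← map_add, hcd, map_one],
    Submodule.mem_span_singleton.mpr ⟨algebraMap A T r, ?_⟩,
    Submodule.mem_span_singleton.mpr ⟨algebraMap A T s, ?_⟩⟩
  · simpa using hr
  · simpa using hs

/-- A partition of unity on a spectrum covered by basic open sets, on each of which one of the
generators `x ∈ S` divides all the others. -/
theorem HasSplitting.exists_partition (h : HasSplitting A K) {S : Finset K} (hS : S.Nonempty) :
    ∃ e : K → A, ∑ x ∈ S, e x = 1 ∧ ∀ x ∈ S, ∀ y ∈ S, e x • y ∈ Submodule.span A {x} := by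
  classical
  induction hS using Finset.Nonempty.cons_induction with
  | singleton a =>
    exact ⟨fun _ => 1, by simp, by simp [Submodule.mem_span_singleton_self]⟩
  | cons a S ha hS ih =>
    obtain ⟨e, he, hmem⟩ := ih
    choose c d hcd hc hd using fun x => h a x
    have hne : ∀ x ∈ S, x ≠ a := fun x hx hxa => ha (hxa ▸ hx)
    -- On the part of the spectrum where `x` divides all of `S`, split further according to
    -- whether `x` divides `a` or `a` divides `x`.
    refine ⟨fun x => if x = a then ∑ z ∈ S, e z * d z else e x * c x, ?_, ?_⟩
    · rw [Finset.sum_cons, if_pos rfl,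
        Finset.sum_congr rfl fun x hx => if_neg (hne x hx), ← Finset.sum_add_distrib, ← he]
      refine Finset.sum_congr rfl fun x _ => ?_
      rw [← mul_add, add_comm, hcd, mul_one]
    · intro x hx y hy
      rw [Finset.mem_cons] at hx hy
      rcases hx with rfl | hx
      · simp only [if_true, Finset.sum_smul]
        refine Submodule.sum_mem _ fun z hz => ?_
        rcases hy with rfl | hy
        · exact Submodule.smul_mem _ _ (Submodule.mem_span_singleton_self _)
        · obtain ⟨r, hr⟩ := Submodule.mem_span_singleton.mp (hmem z hz y hy)
          rw [mul_comm, mul_smul, ← hr, smul_comm]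
          exact Submodule.smul_mem _ _ (hd z)
      · simp only [if_neg (hne x hx)]
        rcases hy with rfl | hy
        · rw [mul_smul]
          exact Submodule.smul_mem _ _ (hc x)
        · rw [mul_comm, mul_smul]
          exact Submodule.smul_mem _ _ (hmem x hx y hy)

namespace NonzeroFracIdeal

theorem mem_unit_iff {x : K} :
    x ∈ (unit : NonzeroFracIdeal A K).1 ↔ ∃ r : A, algebraMap A K r = x :=
  FractionalIdeal.mem_one_iff A⁰

theorem exists_mem_ne_zero (E : NonzeroFracIdeal A K) : ∃ x ∈ E.1, x ≠ 0 := by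
  by_contra! h
  exact E.2 (FractionalIdeal.eq_zero_iff.mpr h)

end NonzeroFracIdeal

open NonzeroFracIdeal

section FractionRing

variable [IsFractionRing A K]

namespace NonzeroFracIdeal

theorem mem_scale_iff {a : K} {ha : a ≠ 0} {E : NonzeroFracIdeal A K} {x : K} :
    x ∈ (E.scale a ha).1 ↔ ∃ y ∈ E.1, x = a * y :=
  FractionalIdeal.mem_singleton_mul

theorem le_scale_unit {E : NonzeroFracIdeal A K} {x : K} {hx : x ≠ 0}
    (h : ∀ y ∈ E.1, y ∈ Submodule.span A {x}) : E ≤ unit.scale x hx := by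
  intro y hy
  obtain ⟨r, rfl⟩ := Submodule.mem_span_singleton.mp (h y hy)
  exact mem_scale_iff.mpr ⟨_, mem_unit_iff.mpr ⟨r, rfl⟩, by rw [Algebra.smul_def, mul_comm]⟩

theorem exists_fg_le (E : NonzeroFracIdeal A K) (S : Finset K) (hS : ∀ x ∈ S, x ∈ E.1) :
    ∃ F : NonzeroFracIdeal A K, (F ≤ E ∧ (F.1 : Submodule A K).FG) ∧ ∀ x ∈ S, x ∈ F.1 := by
  classical
  obtain ⟨y, hy, hy0⟩ := E.exists_mem_ne_zero
  -- The generator `y` is added because `S` may be empty or `{0}`.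
  have hfg : (Submodule.span A (insert y S : Finset K) : Submodule A K).FG := ⟨_, rfl⟩
  have hmem : ∀ x ∈ insert y S, x ∈ Submodule.span A ((insert y S : Finset K) : Set K) :=
    fun x hx => Submodule.subset_span hx
  refine ⟨⟨⟨_, FractionalIdeal.isFractional_of_fg hfg⟩, fun h => hy0 ?_⟩, ⟨?_, hfg⟩,
    fun x hx => hmem x (Finset.mem_insert_of_mem hx)⟩
  · exact FractionalIdeal.eq_zero_iff.mp h y (hmem y (Finset.mem_insert_self _ _))
  · change Submodule.span A _ ≤ (E.1 : Submodule A K)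
    rw [Submodule.span_le]
    intro x hx
    rcases Finset.mem_insert.mp (Finset.mem_coe.mp hx) with rfl | hx
    · exact hy
    · exact hS x hx

end NonzeroFracIdeal

theorem HasSplitting.star_eq_of_fg (h : HasSplitting A K) (s : StarOperation A K)
    {F : NonzeroFracIdeal A K} (hF : (F.1 : Submodule A K).FG) : s.star F = F := by
  refine le_antisymm (fun z hz => ?_) (s.le_star F)
  obtain ⟨S, hS⟩ := hF
  obtain ⟨w, hwF, hw⟩ := F.exists_mem_ne_zero
  have hmemF : ∀ y, y ∈ F.1 ↔ y ∈ Submodule.span A (S : Set K) := fun y => by rw [hS]; rfl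
  have hSne : S.Nonempty := by
    rw [Finset.nonempty_iff_ne_empty]
    rintro rfl
    exact hw (by simpa using (hmemF w).mp hwF)
  obtain ⟨e, he, hmem⟩ := h.exists_partition hSne
  have hmul : ∀ x ∈ S, ∀ y ∈ F.1, e x • y ∈ Submodule.span A {x} := by
    intro x hx y hy
    have : Submodule.span A (S : Set K) ≤
        (Submodule.span A {x}).comap (LinearMap.lsmul A K (e x)) :=
      Submodule.span_le.mpr fun y hy => hmem x hx y hy
    exact this ((hmemF y).mp hy)
  have key : ∀ x ∈ S, e x • z ∈ F.1 := by
    intro x hx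
    have hxF : x ∈ F.1 := (hmemF x).mpr (Submodule.subset_span hx)
    by_cases hex : algebraMap A K (e x) = 0
    · rw [Algebra.smul_def, hex, zero_mul]
      exact F.1.zero_mem
    have hx0 : x ≠ 0 := by
      rintro rfl
      have := hmul 0 hx w hwF
      rw [Submodule.span_zero_singleton, Submodule.mem_bot, Algebra.smul_def] at this
      exact (mul_ne_zero hex hw) this
    have hle : F.scale _ hex ≤ unit.scale x hx0 := le_scale_unit fun y hy => by
      obtain ⟨v, hv, rfl⟩ := mem_scale_iff.mp hy
      rw [← Algebra.smul_def]
      exact hmul x hx v hv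
    have hle' := s.star_mono _ _ hle
    rw [s.star_scale, s.star_scale, s.star_unit] at hle'
    obtain ⟨v, hv, hzv⟩ := mem_scale_iff.mp (hle' (mem_scale_iff.mpr ⟨z, hz, rfl⟩))
    obtain ⟨r, rfl⟩ := mem_unit_iff.mp hv
    rw [Algebra.smul_def, hzv, mul_comm, ← Algebra.smul_def]
    exact (F.1 : Submodule A K).smul_mem r hxF
  have hz' : ∑ x ∈ S, e x • z ∈ (F.1 : Submodule A K) := Submodule.sum_mem _ key
  rwa [← Finset.sum_smul, he, one_smul] at hz'

theorem HasSplitting.star_eq (h : HasSplitting A K) {s : StarOperation A K}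
    (hs : s ∈ StarFC A K) (E : NonzeroFracIdeal A K) : s.star E = E := by
  refine le_antisymm (fun x hx => ?_) (s.le_star E)
  have hx' : x ∈ {x : K | x ∈ (s.star E).1} := hx
  rw [hs E] at hx'
  simp only [Set.mem_iUnion] at hx'
  obtain ⟨F, ⟨hFE, hF⟩, hxF⟩ := hx'
  rw [h.star_eq_of_fg s hF] at hxF
  exact hFE hxF

theorem HasSplitting.subsingleton_starFC (h : HasSplitting A K) : (StarFC A K).Subsingleton :=
  fun s hs t ht => StarOperation.ext (funext fun E => by rw [h.star_eq hs, h.star_eq ht])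

end FractionRing

/-! ### The star operation defined by two overrings -/

/-- A common denominator of `E` is also a common denominator of `E S₁ ∩ E S₂`. -/
theorem mem_extension_inf_of_eq_bot {S₁ S₂ : Subalgebra A K} (h : S₁ ⊓ S₂ = ⊥) {E : Submodule A K}
    {a : K} (ha : ∀ y ∈ E, ∃ r : A, algebraMap A K r = a * y) {x : K}
    (h₁ : x ∈ E * S₁.toSubmodule) (h₂ : x ∈ E * S₂.toSubmodule) :
    ∃ r : A, algebraMap A K r = a * x := by
  have aux : ∀ (S : Subalgebra A K) (z : K), z ∈ E * S.toSubmodule → a * z ∈ S := by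
    intro S z hS
    induction hS using Submodule.mul_induction_on' with
    | mem_mul_mem y hy z hz =>
      obtain ⟨r, hr⟩ := ha y hy
      rw [← mul_assoc, ← hr]
      exact S.mul_mem (S.algebraMap_mem r) hz
    | add y _ z _ hy hz =>
      rw [mul_add]
      exact S.add_mem hy hz
  have : a * x ∈ S₁ ⊓ S₂ := ⟨aux S₁ x h₁, aux S₂ x h₂⟩
  rw [h] at this
  exact Algebra.mem_bot.mp this

theorem le_mul_toSubmodule (E : Submodule A K) (S : Subalgebra A K) : E ≤ E * S.toSubmodule :=
  fun x hx => by
    simpa using Submodule.mul_mem_mul hx (show (1 : K) ∈ S.toSubmodule from S.one_mem)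

theorem exists_aeval_of_mem_span_pair_mul_adjoin {v w x : K}
    (h : x ∈ Submodule.span A {1, v} * (Algebra.adjoin A {w}).toSubmodule) :
    ∃ p q : A[X], x = aeval w p + v * aeval w q := by
  rw [Submodule.span_insert, Submodule.sup_mul, Submodule.mem_sup] at h
  obtain ⟨y, hy, z, hz, rfl⟩ := h
  obtain ⟨y', hy', rfl⟩ := Submodule.mem_span_singleton_mul.mp hy
  obtain ⟨z', hz', rfl⟩ := Submodule.mem_span_singleton_mul.mp hz
  rw [Subalgebra.mem_toSubmodule, Algebra.adjoin_singleton_eq_range_aeval] at hy' hz'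
  obtain ⟨p, rfl⟩ := hy'
  obtain ⟨q, rfl⟩ := hz'
  exact ⟨p, q, by simp⟩

section FractionRing

variable [IsFractionRing A K]

/-- The star operation `E ↦ E S₁ ∩ E S₂` defined by two overrings `S₁` and `S₂` whose intersection
is `A`. -/
noncomputable def StarOperation.ofOverrings (S₁ S₂ : Subalgebra A K) (h : S₁ ⊓ S₂ = ⊥) :
    StarOperation A K where
  star E := ⟨⟨(E.1 : Submodule A K) * S₁.toSubmodule ⊓ (E.1 : Submodule A K) * S₂.toSubmodule, by
      obtain ⟨a, ha, haE⟩ := E.1.isFractional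
      refine ⟨a, ha, fun x hx => ?_⟩
      obtain ⟨r, hr⟩ := mem_extension_inf_of_eq_bot h (a := algebraMap A K a)
        (fun y hy => by rw [← Algebra.smul_def]; exact haE y hy) hx.1 hx.2
      exact ⟨r, by rw [Algebra.smul_def]; exact hr⟩⟩, by
    obtain ⟨x, hx, hx0⟩ := E.exists_mem_ne_zero
    exact fun h0 => hx0 (FractionalIdeal.eq_zero_iff.mp h0 x
      ⟨le_mul_toSubmodule _ _ hx, le_mul_toSubmodule _ _ hx⟩)⟩
  star_unit := by
    refine le_antisymm (fun x hx => ?_)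
      (fun x hx => ⟨le_mul_toSubmodule _ _ hx, le_mul_toSubmodule _ _ hx⟩)
    obtain ⟨r, hr⟩ := mem_extension_inf_of_eq_bot h (a := 1)
      (fun y hy => by simpa using mem_unit_iff.mp hy) hx.1 hx.2
    exact mem_unit_iff.mpr ⟨r, by simpa using hr⟩
  star_scale a ha E := by
    have aux : ∀ (S : Subalgebra A K) (x : K),
        x ∈ ((E.scale a ha).1 : Submodule A K) * S.toSubmodule ↔
          ∃ y ∈ (E.1 : Submodule A K) * S.toSubmodule, a * y = x := by
      intro S x
      rw [NonzeroFracIdeal.scale, FractionalIdeal.coe_mul, FractionalIdeal.coe_spanSingleton,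
        mul_assoc, Submodule.mem_span_singleton_mul]
    refine Subtype.ext (SetLike.ext fun x => ?_)
    rw [mem_scale_iff]
    refine (and_congr (aux S₁ x) (aux S₂ x)).trans ⟨?_, ?_⟩
    · rintro ⟨⟨y, hy, rfl⟩, z, hz, hyz⟩
      obtain rfl := mul_left_cancel₀ ha hyz
      exact ⟨z, ⟨hy, hz⟩, rfl⟩
    · rintro ⟨y, hy, rfl⟩
      exact ⟨⟨y, hy.1, rfl⟩, y, hy.2, rfl⟩
  le_star E := fun x hx => ⟨le_mul_toSubmodule _ _ hx, le_mul_toSubmodule _ _ hx⟩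
  star_mono E F hEF := fun x hx =>
    ⟨mul_le_mul' (FractionalIdeal.coe_le_coe.mpr hEF) le_rfl hx.1,
      mul_le_mul' (FractionalIdeal.coe_le_coe.mpr hEF) le_rfl hx.2⟩
  star_star E := by
    have aux : ∀ (S : Subalgebra A K) (M : Submodule A K),
        M ≤ (E.1 : Submodule A K) * S.toSubmodule →
        M * S.toSubmodule ≤ (E.1 : Submodule A K) * S.toSubmodule := by
      intro S M hM
      refine (mul_le_mul' hM le_rfl).trans ?_
      rw [mul_assoc, S.isIdempotentElem_toSubmodule]
    exact le_antisymm (fun x hx => ⟨aux S₁ _ inf_le_left hx.1, aux S₂ _ inf_le_right hx.2⟩)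
      (fun x hx => ⟨le_mul_toSubmodule _ _ hx, le_mul_toSubmodule _ _ hx⟩)

theorem StarOperation.mem_star_ofOverrings {S₁ S₂ : Subalgebra A K} {h : S₁ ⊓ S₂ = ⊥}
    {E : NonzeroFracIdeal A K} {x : K} :
    x ∈ ((ofOverrings S₁ S₂ h).star E).1 ↔
      x ∈ (E.1 : Submodule A K) * S₁.toSubmodule ∧ x ∈ (E.1 : Submodule A K) * S₂.toSubmodule :=
  Iff.rfl

theorem StarOperation.ofOverrings_mem_starFC (S₁ S₂ : Subalgebra A K) (h : S₁ ⊓ S₂ = ⊥) :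
    ofOverrings S₁ S₂ h ∈ StarFC A K := by
  classical
  intro E
  refine Set.Subset.antisymm (fun x hx => ?_) (fun x hx => ?_)
  · have aux : ∀ S : Subalgebra A K, x ∈ (E.1 : Submodule A K) * S.toSubmodule →
        ∃ T : Finset K, (∀ t ∈ T, t ∈ E.1) ∧
          x ∈ Submodule.span A (T : Set K) * S.toSubmodule := by
      intro S hS
      obtain ⟨T, T', hT, hT', hxT⟩ := Submodule.mem_span_mul_finite_of_mem_mul hS
      refine ⟨T, hT, ?_⟩
      rw [← Submodule.span_mul_span] at hxT
      exact mul_le_mul' le_rfl (Submodule.span_le.mpr hT') hxT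
    obtain ⟨T₁, hT₁, hx₁⟩ := aux S₁ hx.1
    obtain ⟨T₂, hT₂, hx₂⟩ := aux S₂ hx.2
    obtain ⟨F, hF, hTF⟩ := E.exists_fg_le (T₁ ∪ T₂) fun x hx =>
      (Finset.mem_union.mp hx).elim (hT₁ x) (hT₂ x)
    have hle : ∀ T : Finset K, T ⊆ T₁ ∪ T₂ →
        Submodule.span A (T : Set K) ≤ (F.1 : Submodule A K) :=
      fun T hT => Submodule.span_le.mpr fun t ht => hTF t (hT ht)
    simp only [Set.mem_iUnion]
    exact ⟨F, hF, mul_le_mul' (hle _ Finset.subset_union_left) le_rfl hx₁,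
      mul_le_mul' (hle _ Finset.subset_union_right) le_rfl hx₂⟩
  · simp only [Set.mem_iUnion] at hx
    obtain ⟨F, hF, hxF⟩ := hx
    exact (ofOverrings S₁ S₂ h).star_mono F E hF.1 hxF

theorem nonempty_starFC : (StarFC A K).Nonempty :=
  ⟨_, StarOperation.ofOverrings_mem_starFC ⊥ ⊥ (inf_idem _)⟩

/-! ### Integrally closed domains -/

section IsIntegrallyClosed

variable [IsIntegrallyClosed A]

/-- If `A` is integrally closed, every coefficient of a polynomial over `A` vanishing at `u` is a
sum of a denominator of `u` and a denominator of `u⁻¹`. The leading term is removed by merging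
`a u ∈ A`, for `a` the leading coefficient, into the next coefficient. -/
theorem exists_coeff_eq_add {u : K} {f : A[X]} (hf : aeval u f = 0) (k : ℕ) :
    ∃ b g : A, f.coeff k = b + g ∧ (∃ r, algebraMap A K r = algebraMap A K b * u) ∧
      ∃ r, algebraMap A K r * u = algebraMap A K g := by
  obtain ⟨d, hd⟩ : ∃ d, f.natDegree ≤ d := ⟨_, le_rfl⟩
  induction d generalizing f k with
  | zero =>
    have hf0 : f = 0 := by
      rw [eq_C_of_natDegree_le_zero hd, aeval_C] at hf
      rw [eq_C_of_natDegree_le_zero hd, (IsFractionRing.injective A K) (hf.trans (map_zero _).symm),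
        C_0]
    exact ⟨0, 0, by simp [hf0], ⟨0, by simp⟩, 0, by simp⟩
  | succ d ih =>
    obtain ⟨s, hs⟩ : ∃ s, algebraMap A K s = algebraMap A K (f.coeff (d + 1)) * u := by
      rcases hd.lt_or_eq with hlt | heq
      · exact ⟨0, by simp [coeff_eq_zero_of_natDegree_lt hlt]⟩
      · obtain ⟨s, hs⟩ := IsIntegrallyClosed.isIntegral_iff.mp (isIntegral_leadingCoeff_smul f u hf)
        exact ⟨s, by rw [hs, Algebra.smul_def, leadingCoeff, heq]⟩
    let f' : A[X] := f - C (f.coeff (d + 1)) * X ^ (d + 1) + C s * X ^ d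
    have hcoeff : ∀ i, f'.coeff i =
        f.coeff i - (if i = d + 1 then f.coeff (d + 1) else 0) + if i = d then s else 0 := by
      intro i
      simp [f', coeff_C_mul, coeff_X_pow]
    have hf' : aeval u f' = 0 := by
      simp only [f', map_add, map_sub, map_mul, map_pow, aeval_C, aeval_X, hf, hs]
      ring
    have hd' : f'.natDegree ≤ d := by
      rw [natDegree_le_iff_coeff_eq_zero]
      intro i hi
      rw [hcoeff, if_neg hi.ne']
      by_cases hi' : i = d + 1
      · simp [hi']
      · rw [if_neg hi', coeff_eq_zero_of_natDegree_lt (by omega)]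
        simp
    obtain ⟨b, g, hbg, hb, r, hr⟩ := ih hf' k hd'
    rw [hcoeff] at hbg
    by_cases hk : k = d + 1
    · exact ⟨f.coeff k, 0, by simp, ⟨s, by rw [hs, hk]⟩, 0, by simp⟩
    by_cases hk' : k = d
    · refine ⟨b, g - s, ?_, hb, r - f.coeff (d + 1), ?_⟩
      · rw [if_neg hk, if_pos hk', sub_zero] at hbg
        rw [add_sub, ← hbg, add_sub_cancel_right]
      · rw [map_sub, map_sub, hs, sub_mul, hr]
    · rw [if_neg hk, if_neg hk', sub_zero, add_zero] at hbg
      exact ⟨b, g, hbg, hb, r, hr⟩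

/-- A valuation ring of `K` contains `v` or `v⁻¹`, hence one of the two overrings, and `A` is an
intersection of valuation rings. -/
theorem adjoin_inf_adjoin_inv_eq_bot (v : K) :
    Algebra.adjoin A {v} ⊓ Algebra.adjoin A {v⁻¹} = ⊥ := by
  refine le_bot_iff.mp fun x hx => ?_
  rw [← IsIntegrallyClosed.integralClosure_eq_bot A K]
  by_contra hxA
  obtain ⟨V, hAV, hxV⟩ := Subring.exists_le_valuationSubring_of_isIntegrallyClosedIn
    (R := (integralClosure A K).toSubring) hxA
  have key : ∀ w ∈ V, ∀ z ∈ Algebra.adjoin A {w}, z ∈ V := by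
    intro w hw z hz
    induction hz using Algebra.adjoin_induction with
    | mem y hy => rwa [Set.mem_singleton_iff.mp hy]
    | algebraMap r => exact hAV ((integralClosure A K).algebraMap_mem r)
    | add y z _ _ hy hz => exact V.add_mem _ _ hy hz
    | mul y z _ _ hy hz => exact V.mul_mem _ _ hy hz
  exact hxV ((V.mem_or_inv_mem v).elim (fun h => key _ h x hx.1) (fun h => key _ h x hx.2))

/-- The star operation `E ↦ E A[v] ∩ E A[v⁻¹]` on an integrally closed domain. -/
noncomputable def StarOperation.ofAdjoin (v : K) : StarOperation A K :=
  ofOverrings _ _ (adjoin_inf_adjoin_inv_eq_bot v)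

variable (A) in
/-- The fractional ideal generated by `1` and `v`. -/
noncomputable def NonzeroFracIdeal.spanOnePair (v : K) : NonzeroFracIdeal A K :=
  ⟨⟨Submodule.span A {1, v}, FractionalIdeal.isFractional_of_fg (Submodule.fg_span (by simp))⟩, fun h =>
    one_ne_zero (FractionalIdeal.eq_zero_iff.mp h (1 : K) (Submodule.subset_span (by simp)))⟩

/-- The images of the ideals `(1, u²ᵐ)` recover `n` from the star operation attached to `uⁿ`, as
soon as the denominators of `u` and those of `u⁻¹` generate a proper ideal of `A`. -/
theorem pow_mem_star_ofAdjoin_iff {u : K} (hu : u ≠ 0)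
    (h : ∀ b g : A, (∃ r, algebraMap A K r = algebraMap A K b * u) →
      (∃ r, algebraMap A K r * u = algebraMap A K g) → b + g ≠ 1)
    {m n : ℕ} (hm : 0 < m) (hn : 0 < n) :
    u ^ m ∈ ((StarOperation.ofAdjoin (A := A) (u ^ n)).star (spanOnePair A (u ^ (2 * m)))).1 ↔
      n ∣ m := by
  refine StarOperation.mem_star_ofOverrings.trans ⟨fun hmem => ?_, ?_⟩
  · by_contra hnm
    obtain ⟨p, q, hpq⟩ := exists_aeval_of_mem_span_pair_mul_adjoin hmem.1
    have h0 : aeval u (X ^ m - (expand A n p + X ^ (2 * m) * expand A n q)) = 0 := by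
      simp only [map_sub, map_add, map_mul, map_pow, aeval_X, expand_aeval]
      rw [← hpq, sub_self]
    obtain ⟨b, g, hbg, hb, hg⟩ := exists_coeff_eq_add h0 m
    refine h b g hb hg ?_
    -- The term `X ^ (2 * m) * _` does not contribute to the `m`-th coefficient, as `m < 2 * m`.
    rw [← hbg, coeff_sub, coeff_add, coeff_X_pow_self, coeff_expand hn, if_neg hnm,
      coeff_X_pow_mul', if_neg (by omega), add_zero, sub_zero]
  · rintro ⟨k, rfl⟩
    refine ⟨?_, ?_⟩
    · have : u ^ (n * k) = 1 * (u ^ n) ^ k := by rw [one_mul, pow_mul]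
      rw [this]
      exact Submodule.mul_mem_mul (Submodule.subset_span (by simp))
        ((Subalgebra.mem_toSubmodule _).mpr (pow_mem (Algebra.self_mem_adjoin_singleton A _) k))
    · have : u ^ (n * k) = u ^ (2 * (n * k)) * (u ^ n)⁻¹ ^ k := by
        rw [inv_pow, ← pow_mul, two_mul, pow_add, mul_inv_cancel_right₀ (pow_ne_zero _ hu)]
      rw [this]
      exact Submodule.mul_mem_mul (Submodule.subset_span (by simp))
        ((Subalgebra.mem_toSubmodule _).mpr (pow_mem (Algebra.self_mem_adjoin_singleton A _) k))

theorem infinite_starFC (h : ¬ HasSplitting A K) : (StarFC A K).Infinite := by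
  obtain ⟨x, y, hxy⟩ : ∃ x y : K, ∀ c d : A, c + d = 1 → c • x ∈ Submodule.span A {y} →
      d • y ∉ Submodule.span A {x} := by
    simpa only [HasSplitting, not_forall, not_exists, not_and] using h
  have hx : x ≠ 0 := by
    rintro rfl
    exact hxy 1 0 (add_zero _) (by simp) (by simp)
  have hy : y ≠ 0 := by
    rintro rfl
    exact hxy 0 1 (zero_add _) (by simp) (by simp)
  have hu : x / y ≠ 0 := div_ne_zero hx hy
  have hsplit : ∀ b g : A, (∃ r, algebraMap A K r = algebraMap A K b * (x / y)) →
      (∃ r, algebraMap A K r * (x / y) = algebraMap A K g) → b + g ≠ 1 := by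
    rintro b g ⟨r, hr⟩ ⟨s, hs⟩ hbg
    refine hxy b g hbg (Submodule.mem_span_singleton.mpr ⟨r, ?_⟩)
      (Submodule.mem_span_singleton.mpr ⟨s, ?_⟩)
    · rw [Algebra.smul_def, Algebra.smul_def, hr]
      field_simp
    · rw [Algebra.smul_def, Algebra.smul_def, ← hs]
      field_simp
  refine Set.infinite_of_injective_forall_mem
    (f := fun n : ℕ => StarOperation.ofAdjoin (A := A) ((x / y) ^ (n + 1))) (fun m n hmn => ?_)
    fun n => StarOperation.ofOverrings_mem_starFC _ _ _
  have key : ∀ k : ℕ, m + 1 ∣ k + 1 ↔ n + 1 ∣ k + 1 := fun k => by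
    rw [← pow_mem_star_ofAdjoin_iff hu hsplit k.succ_pos m.succ_pos,
      ← pow_mem_star_ofAdjoin_iff hu hsplit k.succ_pos n.succ_pos]
    exact iff_of_eq (congrArg (fun s : StarOperation A K => _ ∈ (s.star _).1) hmn)
  exact Nat.succ_injective (Nat.dvd_antisymm ((key n).mpr dvd_rfl) ((key m).mp dvd_rfl))

end IsIntegrallyClosed

end FractionRing

end

theorem mainTheorem4 {R : Type*} [CommRing R] [IsDomain R] [IsIntegrallyClosed R]
    (K : Type*) [Field K] [Algebra R K] [IsFractionRing R K] :
    IsFinitelyStarRegular R K := by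
  intro T
  by_cases h : HasSplitting R K
  · exact (Set.encard_le_one_iff_subsingleton.mpr (h.subalgebra T).subsingleton_starFC).trans
      (Set.one_le_encard_iff_nonempty.mpr nonempty_starFC)
  · rw [(infinite_starFC h).encard_eq]
    exact le_top
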